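/- Let $\mathrm{W}(\mathbf{H}_4)$ be the Coxeter group of type $\mathbf{H}_4$ (a finite group), let $\mathfrak{A}_8$ be the alternating group on $8$ letters, and let $\mathrm{A}_4\subset\mathfrak{S}_4$ be the Klein group, consisting of the identity and the three double transpositions. Let $\mathrm{A}_4\ltimes\{\pm1\}^4$ be the semidirect product in which $\mathrm{A}_4$ acts on $\{\pm1\}^4$ via its inclusion in $\mathfrak{S}_4$, that is, by permuting the four factors. Let $\mathrm{Q}_8=\{\pm1,\pm\mathbf{i},\pm\mathbf{j},\pm\mathbf{k}\}$ be the quaternion group, and let $\mathfrak{S}_2\ltimes(\mathrm{Q}_8\times\mathrm{Q}_8)$ be the semidirect product in which $\mathfrak{S}_2$ acts by permuting the two factors. Then: 1. the quotient group $(\mathfrak{S}_2\ltimes(\mathrm{Q}_8\times\mathrm{Q}_8))/\langle(-1,-1)\rangle$ is isomorphic to $\mathrm{A}_4\ltimes\{\pm1\}^4$; 2. every $2$-Sylow subgroup of $\mathrm{W}(\mathbf{H}_4)$ and every $2$-Sylow subgroup of $\mathfrak{A}_8$ are isomorphic to each other, and both are isomorphic to $\mathrm{A}_4\ltimes\{\pm1\}^4$.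 -/

import Mathlib

open scoped Quaternion

noncomputable section

namespace Quat

/-- The quaternion `i`. -/
def i : ℍ[ℝ] := ⟨0, 1, 0, 0⟩

/-- The quaternion `j`. -/
def j : ℍ[ℝ] := ⟨0, 0, 1, 0⟩

/-- The quaternion `k`. -/
def k : ℍ[ℝ] := ⟨0, 0, 0, 1⟩

theorem i_mul_i : i * i = -1 := by ext <;> simp <;> simp [i]

theorem j_mul_j : j * j = -1 := by ext <;> simp <;> simp [j]

theorem k_mul_k : k * k = -1 := by ext <;> simp <;> simp [k]

theorem i_mul_j : i * j = k := by ext <;> simp <;> simp [i, j, k]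

theorem j_mul_i : j * i = -k := by ext <;> simp <;> simp [i, j, k]

theorem j_mul_k : j * k = i := by ext <;> simp <;> simp [i, j, k]

theorem k_mul_j : k * j = -i := by ext <;> simp <;> simp [i, j, k]

theorem k_mul_i : k * i = j := by ext <;> simp <;> simp [i, j, k]

theorem i_mul_k : i * k = -j := by ext <;> simp <;> simp [i, j, k]

end Quat

/-- The quaternion group `{±1, ±i, ±j, ±k}`, as a subgroup of the multiplicative group of the
real quaternions. -/
def Q8 : Subgroup ℍ[ℝ]ˣ where
  carrier := {x | (x : ℍ[ℝ]) = 1 ∨ (x : ℍ[ℝ]) = -1 ∨ (x : ℍ[ℝ]) = Quat.i ∨ (x : ℍ[ℝ]) = -Quat.i ∨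
    (x : ℍ[ℝ]) = Quat.j ∨ (x : ℍ[ℝ]) = -Quat.j ∨ (x : ℍ[ℝ]) = Quat.k ∨ (x : ℍ[ℝ]) = -Quat.k}
  one_mem' := Or.inl rfl
  mul_mem' := by
    rintro a b (h | h | h | h | h | h | h | h) (h' | h' | h' | h' | h' | h' | h' | h') <;>
    simp only [Set.mem_ofPred_eq, Units.val_mul, h, h'] <;>
    simp [Quat.i_mul_i, Quat.j_mul_j, Quat.k_mul_k, Quat.i_mul_j, Quat.j_mul_i,
      Quat.j_mul_k, Quat.k_mul_j, Quat.k_mul_i, Quat.i_mul_k]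
  inv_mem' := by
    rintro a (h | h | h | h | h | h | h | h)
    · exact Or.inl (Units.inv_eq_of_mul_eq_one_right (by simp [h]))
    · exact Or.inr (Or.inl (Units.inv_eq_of_mul_eq_one_right (by simp [h])))
    · exact Or.inr (Or.inr (Or.inr (Or.inl
        (Units.inv_eq_of_mul_eq_one_right (by simp [h, Quat.i_mul_i])))))
    · exact Or.inr (Or.inr (Or.inl
        (Units.inv_eq_of_mul_eq_one_right (by simp [h, Quat.i_mul_i]))))
    · exact Or.inr (Or.inr (Or.inr (Or.inr (Or.inr (Or.inl
        (Units.inv_eq_of_mul_eq_one_right (by simp [h, Quat.j_mul_j])))))))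
    · exact Or.inr (Or.inr (Or.inr (Or.inr (Or.inl
        (Units.inv_eq_of_mul_eq_one_right (by simp [h, Quat.j_mul_j]))))))
    · exact Or.inr (Or.inr (Or.inr (Or.inr (Or.inr (Or.inr (Or.inr
        (Units.inv_eq_of_mul_eq_one_right (by simp [h, Quat.k_mul_k]))))))))
    · exact Or.inr (Or.inr (Or.inr (Or.inr (Or.inr (Or.inr (Or.inl
        (Units.inv_eq_of_mul_eq_one_right (by simp [h, Quat.k_mul_k]))))))))

/-- The element `-1` of `Q8`. -/
def Q8.negOne : Q8 := ⟨-1, Or.inr (Or.inl rfl)⟩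

/-- The semidirect product `𝔖₂ ⋉ (Q₈ × Q₈)`, where `𝔖₂` permutes the two factors
(`mulAutArrow σ f = f ∘ σ⁻¹`). -/
abbrev Q8Wreath : Type :=
  (Fin 2 → Q8) ⋊[(mulAutArrow : Equiv.Perm (Fin 2) →* MulAut (Fin 2 → Q8))] Equiv.Perm (Fin 2)

/-- The subgroup `⟨(-1, -1)⟩` of `𝔖₂ ⋉ (Q₈ × Q₈)`. -/
def Q8Wreath.negOneNegOne : Subgroup Q8Wreath :=
  Subgroup.zpowers (SemidirectProduct.inl fun _ => Q8.negOne)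

instance : Q8Wreath.negOneNegOne.Normal := by
  have hc : (SemidirectProduct.inl fun _ => Q8.negOne : Q8Wreath) ∈ Subgroup.center Q8Wreath := by
    rw [Subgroup.mem_center_iff]
    intro g
    refine SemidirectProduct.ext ?_ ?_
    · funext i
      apply Subtype.ext
      apply Units.ext
      change ((g.left i : ℍ[ℝ]ˣ) : ℍ[ℝ]) * (-1) = (-1) * ((g.left i : ℍ[ℝ]ˣ) : ℍ[ℝ])
      simp
    · simp
  refine ⟨fun n hn g => ?_⟩
  have hn' : n ∈ Subgroup.center Q8Wreath := (Subgroup.zpowers_le.2 hc) hn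
  rw [Subgroup.mem_center_iff.1 hn' g, mul_inv_cancel_right]
  exact hn

/-- The action of the Klein group (the subgroup of `𝔖₄` formed by the identity and the three
double transpositions) on `{±1}⁴`, through its inclusion in `𝔖₄` and the permutation of the
four factors. -/
def kleinAction : alternatingGroup.kleinFour (Fin 4) →* MulAut (Fin 4 → ℤˣ) :=
  (mulAutArrow : Equiv.Perm (Fin 4) →* MulAut (Fin 4 → ℤˣ)).comp
    ((alternatingGroup (Fin 4)).subtype.comp (alternatingGroup.kleinFour (Fin 4)).subtype)

/-- The semidirect product of the Klein group with `{±1}⁴`. -/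
abbrev KleinSemidirect : Type :=
  (Fin 4 → ℤˣ) ⋊[kleinAction] alternatingGroup.kleinFour (Fin 4)

end

/-! All the groups are compared with the group of signed permutations of four coordinates whose
underlying permutation lies in the Klein group. `KleinSemidirect` acts faithfully in this way over
any ring with `1 ≠ -1`, and it has order `64`. So if it embeds in a finite group of order `64 * m`
with `m` odd, its image is a Sylow `2`-subgroup, and all Sylow `2`-subgroups are isomorphic to it by
conjugacy.

For `𝔄₈`, of order `64 * 315`, the embedding is explicit and checked by computation.

For `W(H₄)` the order `14400 = 64 * 225` has to be proved. Upper bound: along the chain of parabolic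
subgroups `A₁ ⊂ I₂(5) ⊂ H₃ ⊂ H₄`, lists of coset representatives of lengths `2, 5, 12, 120` are
closed under multiplication by generators modulo the smaller parabolic subgroup, which is checked
with a rewriting system derived from the braid relations. Lower bound: the reflection representation
over `ℤ[φ]`, with `φ` the golden ratio, is reduced modulo `√5`, so that everything is computable in
`𝔽₅⁴`. Its image contains the signed permutations above, and also products of two commuting cyclic
groups of order `3` and of order `5`; hence `64 * 9 * 25` divides its order. The two bounds force
the representation to be faithful, and the signed permutations lift to `W(H₄)`.

For the quotient, `Q₈ × Q₈` acts on `ℍ = ℝ⁴` by `x ↦ a x b⁻¹` and the transposition acts by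
conjugation. The kernel is `⟨(-1, -1)⟩` and the image is the same group of signed permutations. -/

/-! ### Rewriting words in a group

Words are lists over an alphabet `α`. A rewriting rule is a pair `(p, r)` which replaces the word
`p.reverse` by `r`; storing the left-hand side reversed lets it be matched against the top of
a stack. -/

namespace Rewriting

variable {α : Type*}

section Algorithm

variable [DecidableEq α]

/-- The list `t` with `l = p ++ t`, if there is one. -/
def stripPrefix : List α → List α → Option (List α)
  | [], l => some l
  | _ :: _, [] => none
  | a :: p, b :: l => if a = b then stripPrefix p l else none

theorem eq_append_of_stripPrefix :
    ∀ {p l t : List α}, stripPrefix p l = some t → l = p ++ t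
  | [], l, t, h => by simpa [stripPrefix] using h
  | _ :: _, [], t, h => by simp [stripPrefix] at h
  | a :: p, b :: l, t, h => by
    rw [stripPrefix] at h
    split_ifs at h with hab
    rw [eq_append_of_stripPrefix h, hab, List.cons_append]

/-- The first rule that applies to the top of the stack, with the rest of the stack. -/
def matchTop : List (List α × List α) → List α → Option (List α × List α)
  | [], _ => none
  | (p, r) :: R, l =>
    match stripPrefix p l with
    | some t => some (t, r)
    | none => matchTop R l

/-- Rewrite the word `stack.reverse ++ input`, reading one letter at a time. The result is
returned as a stack. -/
def reduce (R : List (List α × List α)) : ℕ → List α → List α → List α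
  | 0, out, inp => inp.reverse ++ out
  | _ + 1, out, [] => out
  | n + 1, out, a :: inp =>
    match matchTop R (a :: out) with
    | some (t, r) => reduce R n t (r ++ inp)
    | none => reduce R n (a :: out) inp

/-- Adjoin the rule given by the critical pair of the rules numbered `i` and `j` whose left-hand
sides overlap in `o` letters. -/
def adjoinCriticalPair (fuel : ℕ) (R : List (List α × List α)) (c : ℕ × ℕ × ℕ) :
    List (List α × List α) :=
  match R[c.1]?, R[c.2.1]? with
  | some (p, r), some (q, s) =>
    if p.reverse.drop (p.length - c.2.2) ++ q.reverse.drop c.2.2 = q.reverse then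
      R ++ [(reduce R fuel [] (p.reverse.take (p.length - c.2.2) ++ s),
        (reduce R fuel [] (r ++ q.reverse.drop c.2.2)).reverse)]
    else R
  | _, _ => R

end Algorithm

section Soundness

variable {G : Type*} [Monoid G] (g : α → G)

/-- The value of a word in a monoid. -/
def eval (w : List α) : G := (w.map g).prod

@[simp] theorem eval_nil : eval g [] = 1 := rfl

@[simp] theorem eval_cons (a : α) (w : List α) : eval g (a :: w) = g a * eval g w := by
  simp [eval]

@[simp] theorem eval_append (v w : List α) : eval g (v ++ w) = eval g v * eval g w := by
  simp [eval]

/-- All rules hold in the monoid. -/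
def Sound (R : List (List α × List α)) : Prop :=
  ∀ x ∈ R, eval g x.1.reverse = eval g x.2

variable [DecidableEq α] {g} {R : List (List α × List α)}

theorem Sound.matchTop : ∀ {R : List (List α × List α)}, Sound g R →
    ∀ {l t r : List α}, matchTop R l = some (t, r) →
      eval g l.reverse = eval g t.reverse * eval g r
  | [], _, l, t, r, h => by simp [Rewriting.matchTop] at h
  | (p, q) :: R, hR, l, t, r, h => by
    rw [Rewriting.matchTop] at h
    split at h
    · next t' ht' =>
      simp only [Option.some.injEq, Prod.mk.injEq] at h
      obtain ⟨rfl, rfl⟩ := h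
      rw [eq_append_of_stripPrefix ht', List.reverse_append, eval_append,
        hR (p, q) List.mem_cons_self]
    · exact Sound.matchTop (fun x hx => hR x (List.mem_cons_of_mem _ hx)) h

/-- Every step shifts a letter or applies a valid rule. When the fuel runs out the remaining input
is pushed unreduced, so the value is preserved for every `n` and termination plays no role. -/
theorem Sound.eval_reduce (hR : Sound g R) : ∀ (n : ℕ) (out inp : List α),
    eval g (reduce R n out inp).reverse = eval g out.reverse * eval g inp
  | 0, out, inp => by simp [reduce]
  | n + 1, out, [] => by simp [reduce]
  | n + 1, out, a :: inp => by
    rw [reduce]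
    split
    · next t r h =>
      rw [hR.eval_reduce n, eval_append, ← mul_assoc, ← hR.matchTop h]
      simp [mul_assoc]
    · rw [hR.eval_reduce n]
      simp [mul_assoc]

/-- If the left-hand sides are `u o` and `o v`, then `u o v` can be rewritten from either end; the
two results have the same value and so do their reductions. -/
theorem Sound.adjoinCriticalPair (hR : Sound g R) (fuel : ℕ) (c : ℕ × ℕ × ℕ) :
    Sound g (adjoinCriticalPair fuel R c) := by
  unfold Rewriting.adjoinCriticalPair
  split
  · next p r q s hp hq =>
    split_ifs with h
    · intro x hx
      rcases List.mem_append.1 hx with hx | hx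
      · exact hR x hx
      · obtain rfl := List.mem_singleton.1 hx
        have hp' : eval g p.reverse = eval g r := hR _ (List.mem_of_getElem? hp)
        have hq' : eval g q.reverse = eval g s := hR _ (List.mem_of_getElem? hq)
        simp only [hR.eval_reduce, List.reverse_nil, eval_nil, one_mul, eval_append]
        rw [← hp', ← hq']
        nth_rw 1 [← h]
        rw [eval_append, ← mul_assoc, ← eval_append, List.take_append_drop]
    · exact hR
  · exact hR

theorem Sound.foldl_adjoinCriticalPair (fuel : ℕ) :
    ∀ {R : List (List α × List α)} (cs : List (ℕ × ℕ × ℕ)), Sound g R →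
      Sound g (cs.foldl (Rewriting.adjoinCriticalPair fuel) R)
  | _, [], hR => hR
  | _, c :: cs, hR => Sound.foldl_adjoinCriticalPair fuel cs (hR.adjoinCriticalPair fuel c)

end Soundness

/-! ### Coset enumeration -/

variable [DecidableEq α]

/-- The irreducible words obtained from the words in the list `L` (all reversed) by appending at
most `fuel` letters from `A`. -/
def extensions (R : List (List α × List α)) (A : List α) : ℕ → List (List α) → List (List α)
  | 0, L => L
  | n + 1, L => L ++ extensions R A n
      (L.flatMap fun v => (A.map (· :: v)).filter fun w => (matchTop R w).isNone)

/-- Every product of a word in `T` with a letter of `A` reduces to a word in `T`, possibly preceded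
by one letter of `B`. -/
def IsTransversal (fuel : ℕ) (R : List (List α × List α)) (B A : List α)
    (T : List (List α)) : Bool :=
  T.contains [] && T.all fun v => A.all fun s =>
    let x := reduce R fuel v [s]
    T.contains x || match x.reverse with
      | [] => false
      | b :: y => B.contains b && T.contains y.reverse

open scoped Pointwise in
/-- If a set contains the neutral element and is closed under right multiplication by the letters
in `B`, then its product with a transversal is closed under right multiplication by the letters in
`A`. -/
theorem IsTransversal.mul_mem {G : Type*} [Monoid G] {g : α → G} {R : List (List α × List α)}
    (hR : Sound g R) {fuel : ℕ} {B A : List α} {T : List (List α)}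
    (hT : IsTransversal fuel R B A T) {E : Set G} (hE : ∀ x ∈ E, ∀ b ∈ B, x * g b ∈ E) :
    ∀ x ∈ E * {y | ∃ v ∈ T, eval g v.reverse = y}, ∀ a ∈ A,
      x * g a ∈ E * {y | ∃ v ∈ T, eval g v.reverse = y} := by
  rintro _ ⟨x, hx, _, ⟨v, hv, rfl⟩, rfl⟩ a ha
  simp only [IsTransversal, Bool.and_eq_true, List.all_eq_true] at hT
  have h := hT.2 v hv a ha
  have hval : eval g v.reverse * g a = eval g (reduce R fuel v [a]).reverse := by
    rw [hR.eval_reduce]; simp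
  simp only [mul_assoc, hval]
  rcases Bool.or_eq_true _ _ ▸ h with h | h
  · exact ⟨x, hx, _, ⟨_, by simpa using h, rfl⟩, rfl⟩
  · split at h
    · simp at h
    · next b y hy =>
      simp only [Bool.and_eq_true, List.contains_iff_mem] at h
      rw [hy, eval_cons, ← mul_assoc]
      exact ⟨_, hE x hx b h.1, _, ⟨_, h.2, by rw [List.reverse_reverse]⟩, rfl⟩

theorem IsTransversal.nil_mem {R : List (List α × List α)} {fuel : ℕ} {B A : List α}
    {T : List (List α)} (hT : IsTransversal fuel R B A T) : [] ∈ T := by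
  simp only [IsTransversal, Bool.and_eq_true] at hT
  simpa using hT.1

end Rewriting

/-! ### The order of the Coxeter group of type `H₄` is at most `14400` -/

namespace CoxeterH4

open Rewriting CoxeterMatrix

/-- The defining relations, oriented as rewriting rules. The letter `i` stands for the simple
reflection numbered `3 - i`. -/
def braidRules : List (List (Fin 4) × List (Fin 4)) :=
  [([0, 0], []), ([1, 1], []), ([2, 2], []), ([3, 3], []), ([1, 0, 1, 0, 1], [0, 1, 0, 1, 0]),
    ([0, 2], [0, 2]), ([2, 1, 2], [1, 2, 1]), ([0, 3], [0, 3]), ([1, 3], [1, 3]),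
    ([3, 2, 3], [2, 3, 2])]

/-- A complete rewriting system. -/
def rules : List (List (Fin 4) × List (Fin 4)) :=
  [(6, 5, 1), (9, 8, 1), (11, 7, 1), (10, 6, 1), (12, 8, 1), (14, 7, 1), (14, 9, 1), (15, 9, 1),
    (13, 4, 1), (17, 6, 1), (19, 4, 1), (20, 18, 5), (21, 21, 10), (22, 20, 9), (23, 13, 4),
    (24, 5, 1), (24, 16, 6), (25, 17, 7), (27, 8, 1), (28, 7, 1), (29, 8, 1),
    (30, 9, 1)].foldl (adjoinCriticalPair 1000) braidRules

/-- Representatives of the right cosets of the parabolic subgroup generated by the letters smaller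
than `n` in the one generated by the letters up to `n`. -/
def cosetWords (n : Fin 4) : List (List (Fin 4)) :=
  [] :: extensions rules ((List.finRange 4).filter (· ≤ n)) 45 [[n]]

/-- For a minimal coset representative `v` and a generator `s`, either `v s` is again minimal or `v
s = b v` with `b` a generator of the parabolic subgroup; this is why one letter of `B` suffices. The
`45` rounds of extension are enough because the longest minimal representative of a coset of `H₃` in
`H₄` has length `60 - 15 = 45`. -/
theorem cosetWords_isTransversal : ∀ n : Fin 4, IsTransversal 1000 rules
    ((List.finRange 4).filter (· < n)) ((List.finRange 4).filter (· ≤ n)) (cosetWords n) := by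
  decide +kernel

theorem length_cosetWords : (cosetWords 0).length = 2 ∧ (cosetWords 1).length = 5 ∧
    (cosetWords 2).length = 12 ∧ (cosetWords 3).length = 120 := by
  decide +kernel

/-- The simple reflection that a letter stands for. -/
def gen (i : Fin 4) : H₄.Group := H₄.simple i.rev

theorem gen_mul_self (i : Fin 4) : gen i * gen i = 1 :=
  H₄.toCoxeterSystem.simple_mul_simple_self i.rev

theorem gen_mul_gen_pow (i j : Fin 4) : (gen i * gen j) ^ H₄ i.rev j.rev = 1 :=
  H₄.toCoxeterSystem.simple_mul_simple_pow i.rev j.rev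

theorem sound_braidRules : Sound gen braidRules := by
  have hinv (i : Fin 4) : (gen i)⁻¹ = gen i := inv_eq_of_mul_eq_one_left (gen_mul_self i)
  have h2 (i j : Fin 4) (h : H₄ i.rev j.rev = 2) : gen i * gen j = gen j * gen i := by
    have := gen_mul_gen_pow i j
    rw [h, pow_two, mul_eq_one_iff_eq_inv] at this
    simpa [hinv] using this
  have h3 (i j : Fin 4) (h : H₄ i.rev j.rev = 3) :
      gen i * (gen j * gen i) = gen j * (gen i * gen j) := by
    have := gen_mul_gen_pow i j
    rw [h, show (gen i * gen j) ^ 3 = (gen i * (gen j * gen i)) * (gen j * (gen i * gen j)) by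
      simp [pow_succ, mul_assoc], mul_eq_one_iff_eq_inv] at this
    simpa [hinv, mul_assoc] using this
  have h5 (i j : Fin 4) (h : H₄ i.rev j.rev = 5) :
      gen i * (gen j * (gen i * (gen j * gen i))) =
        gen j * (gen i * (gen j * (gen i * gen j))) := by
    have := gen_mul_gen_pow i j
    rw [h, show (gen i * gen j) ^ 5 = (gen i * (gen j * (gen i * (gen j * gen i)))) *
      (gen j * (gen i * (gen j * (gen i * gen j)))) by
      simp [pow_succ, mul_assoc], mul_eq_one_iff_eq_inv] at this
    simpa [hinv, mul_assoc] using this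
  simp only [Sound, braidRules, List.forall_mem_cons, List.reverse_cons, List.reverse_nil,
    List.nil_append, List.cons_append, eval_cons, eval_nil, mul_one, gen_mul_self, true_and]
  exact ⟨h5 1 0 rfl, h2 2 0 rfl, h3 2 1 rfl, h2 3 0 rfl, h2 3 1 rfl, h3 3 2 rfl, by simp⟩

/-- Only soundness is used. Neither confluence nor termination of `rules` enters: a poor choice of
critical pairs could only make the finite checks fail. -/
theorem sound_rules : Sound gen rules := sound_braidRules.foldl_adjoinCriticalPair _ _

open scoped Pointwise

/-- The elements represented by the coset words. -/
def cosetReps (n : Fin 4) : Set H₄.Group := {y | ∃ v ∈ cosetWords n, eval gen v.reverse = y}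

theorem cosetReps_eq_image (n : Fin 4) :
    cosetReps n = (fun v : List (Fin 4) => eval gen v.reverse) ''
      ((cosetWords n).toFinset : Set (List (Fin 4))) := by
  ext y
  simp [cosetReps]

theorem finite_cosetReps (n : Fin 4) : (cosetReps n).Finite := by
  rw [cosetReps_eq_image]
  exact (Finset.finite_toSet _).image _

theorem card_cosetReps_le (n : Fin 4) : Nat.card (cosetReps n) ≤ (cosetWords n).length := by
  rw [cosetReps_eq_image, Nat.card_coe_set_eq]
  refine (Set.ncard_image_le (Finset.finite_toSet _)).trans ?_
  rw [Set.ncard_coe_finset]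
  exact List.toFinset_card_le _

theorem one_mem_cosetReps (n : Fin 4) : 1 ∈ cosetReps n :=
  ⟨[], IsTransversal.nil_mem (cosetWords_isTransversal n), rfl⟩

/-- By induction on `n`, the product of the sets up to `cosetReps n` is stable under right
multiplication by the letters `≤ n`. For `n = 3` these are all the generators. -/
theorem cosetReps_mul_eq_univ :
    cosetReps 0 * cosetReps 1 * cosetReps 2 * cosetReps 3 = Set.univ := by
  have h (n : Fin 4) (E : Set H₄.Group) (hE : ∀ x ∈ E, ∀ b < n, x * gen b ∈ E) :
      ∀ x ∈ E * cosetReps n, ∀ a ≤ n, x * gen a ∈ E * cosetReps n := fun x hx a ha =>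
    IsTransversal.mul_mem sound_rules (cosetWords_isTransversal n)
      (fun x hx b hb => hE x hx b (by simpa using hb)) x hx a (by simpa using ha)
  have h0 := h 0 1 (by simp)
  rw [one_mul] at h0
  have h1 := h 1 _ fun x hx b hb => h0 x hx b (by omega)
  have h2 := h 2 _ fun x hx b hb => h1 x hx b (by omega)
  have h3 := h 3 _ fun x hx b hb => h2 x hx b (by omega)
  refine Set.eq_univ_of_forall fun w => ?_
  induction w using H₄.toCoxeterSystem.simple_induction_right with
  | one => exact ⟨_, ⟨_, ⟨_, one_mem_cosetReps 0, _, one_mem_cosetReps 1, rfl⟩, _,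
      one_mem_cosetReps 2, rfl⟩, _, one_mem_cosetReps 3, by simp⟩
  | mul_simple_right w i ih =>
    have := h3 w ih i.rev (by omega)
    rwa [gen, Fin.rev_rev] at this

instance finite_group : Finite H₄.Group := by
  rw [← Set.finite_univ_iff, ← cosetReps_mul_eq_univ]
  exact (((finite_cosetReps 0).mul (finite_cosetReps 1)).mul (finite_cosetReps 2)).mul
    (finite_cosetReps 3)

theorem card_group_le : Nat.card H₄.Group ≤ 14400 := by
  obtain ⟨l0, l1, l2, l3⟩ := length_cosetWords
  have c0 := card_cosetReps_le 0
  have c1 := card_cosetReps_le 1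
  have c2 := card_cosetReps_le 2
  have c3 := card_cosetReps_le 3
  rw [l0] at c0; rw [l1] at c1; rw [l2] at c2; rw [l3] at c3
  rw [← Nat.card_univ, ← cosetReps_mul_eq_univ]
  calc _ ≤ _ := Set.natCard_mul_le
    _ ≤ _ := Nat.mul_le_mul_right _ Set.natCard_mul_le
    _ ≤ _ := Nat.mul_le_mul_right _ (Nat.mul_le_mul_right _ Set.natCard_mul_le)
    _ ≤ 2 * 5 * 12 * 120 := by gcongr

end CoxeterH4

/-! ### The group `KleinSemidirect` -/

open Equiv

/-- The permutation in the Klein group that maps `0` to `j`. -/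
def doubleTransposition : Fin 4 → Perm (Fin 4) :=
  ![1, swap 0 1 * swap 2 3, swap 0 2 * swap 1 3, swap 0 3 * swap 1 2]

theorem doubleTransposition_mem (j : Fin 4) :
    doubleTransposition j ∈ alternatingGroup (Fin 4) := by
  rw [Perm.mem_alternatingGroup]
  revert j; decide

/-- The element of the Klein group that maps `0` to `j`. -/
def klein (j : Fin 4) : alternatingGroup.kleinFour (Fin 4) :=
  ⟨⟨doubleTransposition j, doubleTransposition_mem j⟩, by
    have h2 : doubleTransposition j ^ 2 = 1 := by revert j; decide
    have h := alternatingGroup.mem_kleinFour_of_order_two_pow (by simp)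
      (doubleTransposition_mem j) (n := 1) (orderOf_dvd_of_pow_eq_one (by simpa using h2))
    rw [← SetLike.mem_coe, alternatingGroup.coe_kleinFour_of_card_eq_four (by simp)]
    refine h.imp (fun h => ?_) id
    exact Subtype.ext (Perm.cycleType_eq_zero.1 h)⟩

@[simp] theorem coe_klein (j : Fin 4) : ((klein j : alternatingGroup (Fin 4)) : Perm (Fin 4)) =
    doubleTransposition j := rfl

theorem exists_eq_klein (σ : alternatingGroup.kleinFour (Fin 4)) : ∃ j, σ = klein j := by
  have hsign := σ.1.2
  have hsq : ((σ : alternatingGroup (Fin 4)) : Perm (Fin 4)) *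
      ((σ : alternatingGroup (Fin 4)) : Perm (Fin 4)) = 1 := by
    have h := Monoid.pow_exponent_eq_one σ
    rw [alternatingGroup.exponent_kleinFour_of_card_eq_four (by simp), pow_two] at h
    exact congrArg (fun τ : alternatingGroup.kleinFour (Fin 4) => (τ.1 : Perm (Fin 4))) h
  have key : ∀ τ : Perm (Fin 4), Perm.sign τ = 1 → τ * τ = 1 → ∃ j, τ = doubleTransposition j := by
    decide
  obtain ⟨j, hj⟩ := key _ (Perm.mem_alternatingGroup.1 hsign) hsq
  exact ⟨j, Subtype.ext (Subtype.ext hj)⟩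

namespace KleinSemidirect

theorem card : Nat.card KleinSemidirect = 64 := by
  rw [SemidirectProduct.card, alternatingGroup.kleinFour_card_of_card_eq_four (by simp)]
  simp

instance : Finite KleinSemidirect := Nat.finite_of_card_ne_zero (by rw [card]; norm_num)

/-- The change of sign of one coordinate. -/
def signChange (i : Fin 4) : KleinSemidirect := SemidirectProduct.inl (Pi.mulSingle i (-1))

/-- A subgroup is the whole group if it contains the sign changes of one coordinate and is mapped
onto the Klein group. -/
theorem eq_top_of_mem {S : Subgroup KleinSemidirect} (hsign : ∀ i, signChange i ∈ S)
    (hklein : ∀ j, ∃ ε, (⟨ε, klein j⟩ : KleinSemidirect) ∈ S) : S = ⊤ := by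
  have hinl (ε : Fin 4 → ℤˣ) : (SemidirectProduct.inl ε : KleinSemidirect) ∈ S := by
    rw [← Subgroup.mem_comap, ← Finset.univ_prod_mulSingle ε]
    refine Subgroup.prod_mem _ fun i _ => ?_
    rw [Subgroup.mem_comap]
    rcases Int.units_eq_one_or (ε i) with h | h
    · rw [h, Pi.mulSingle_one, map_one]
      exact S.one_mem
    · rw [h]
      exact hsign i
  refine (Subgroup.eq_top_iff' S).2 fun k => ?_
  rw [← SemidirectProduct.inl_left_mul_inr_right k]
  refine S.mul_mem (hinl _) ?_
  obtain ⟨j, hj⟩ := exists_eq_klein k.right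
  obtain ⟨ε, hε⟩ := hklein j
  rw [SemidirectProduct.mk_eq_inl_mul_inr] at hε
  rw [hj]
  exact (S.mul_mem_cancel_left (hinl ε)).1 hε

/-- The action on `R⁴` by signed permutations of the coordinates. -/
def signedPerm (R : Type*) [Ring R] : KleinSemidirect →* Perm (Fin 4 → R) :=
  MonoidHom.toHomPerm
    { toFun k := fun x i => k.left i • x (k.right.1.1⁻¹ i)
      map_one' := by funext x i; simp; rfl
      map_mul' k l := by
        funext x i
        simp only [SemidirectProduct.mul_left, Pi.mul_apply, mul_smul]
        rfl }

variable {R : Type*} [Ring R]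

theorem signedPerm_apply (k : KleinSemidirect) (x : Fin 4 → R) (i : Fin 4) :
    signedPerm R k x i = k.left i • x (k.right.1.1⁻¹ i) := rfl

theorem signedPerm_signChange (i : Fin 4) (x : Fin 4 → R) :
    signedPerm R (signChange i) x = Function.update x i (-x i) := by
  ext l
  rw [signedPerm_apply]
  by_cases h : l = i
  · subst h; simp [signChange]
  · simp [signChange, h]

theorem signedPerm_klein (j : Fin 4) (x : Fin 4 → R) :
    signedPerm R (SemidirectProduct.inr (klein j)) x = x ∘ doubleTransposition j := by
  ext l
  have : (doubleTransposition j)⁻¹ = doubleTransposition j := by revert j; decide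
  simp [signedPerm_apply, this]

/-- The constant vector `1` detects the signs, and the basis vectors then detect the permutation. -/
theorem signedPerm_injective (h : (1 : R) ≠ -1) : Function.Injective (signedPerm R) := by
  have h0 : (1 : R) ≠ 0 := by rintro h0; apply h; rw [h0, neg_zero]
  refine (injective_iff_map_eq_one _).2 fun k hk => ?_
  have hk' (x : Fin 4 → R) (i : Fin 4) : k.left i • x (k.right.1.1⁻¹ i) = x i := by
    rw [← signedPerm_apply, hk, Perm.one_apply]
  have hleft : k.left = 1 := by
    ext1 i
    rcases Int.units_eq_one_or (k.left i) with hi | hi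
    · exact hi
    · have := hk' 1 i
      rw [hi] at this
      simp only [Pi.one_apply, Units.neg_smul, one_smul] at this
      exact absurd this.symm h
  refine SemidirectProduct.ext hleft (Subtype.ext (Subtype.ext ?_))
  rw [SemidirectProduct.one_right, Subgroup.coe_one, Subgroup.coe_one, ← inv_eq_one]
  ext1 i
  have := hk' (Pi.single i 1) i
  rw [hleft, Pi.one_apply, one_smul, Pi.single_eq_same, Pi.single_apply] at this
  by_contra hne
  rw [Perm.one_apply] at hne
  rw [if_neg hne] at this
  exact h0 this.symm

/-- A subgroup contains all signed permutations if it contains the sign changes of one coordinate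
and signed versions of the double transpositions. -/
theorem range_signedPerm_le {S : Subgroup (Perm (Fin 4 → R))}
    (hsign : ∀ i, signedPerm R (signChange i) ∈ S)
    (hklein : ∀ j, ∃ ε, signedPerm R ⟨ε, klein j⟩ ∈ S) :
    (signedPerm R).range ≤ S := by
  rw [MonoidHom.range_eq_map, Subgroup.map_le_iff_le_comap, top_le_iff]
  exact eq_top_of_mem hsign hklein

/-- If `KleinSemidirect` embeds in a finite group whose order is not divisible by `128`, then it is
isomorphic to the Sylow `2`-subgroups. -/
theorem nonempty_sylow_mulEquiv {G : Type*} [Group G] [Finite G] {f : KleinSemidirect →* G}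
    (hf : Function.Injective f) {m : ℕ} (hG : Nat.card G = 64 * m) (hm : Odd m)
    (P : Sylow 2 G) : Nonempty (P ≃* KleinSemidirect) := by
  have hfac : (Nat.card G).factorization 2 = 6 := by
    have hm0 : m ≠ 0 := by rintro rfl; simp at hm
    rw [hG, Nat.factorization_mul (by norm_num) hm0, Finsupp.add_apply,
      Nat.factorization_eq_zero_of_not_dvd (n := m)
        (by rwa [← even_iff_two_dvd, Nat.not_even_iff_odd]),
      show 64 = 2 ^ 6 by norm_num, Nat.Prime.factorization_pow Nat.prime_two]
    simp
  have hcard : Nat.card f.range = 2 ^ (Nat.card G).factorization 2 := by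
    rw [hfac, ← Nat.card_congr (MonoidHom.ofInjective hf).toEquiv, card]
    norm_num
  exact ⟨(P.equiv (Sylow.ofCard f.range hcard)).trans (MonoidHom.ofInjective hf).symm⟩

end KleinSemidirect

/-! ### Sylow subgroups of the alternating group on eight letters -/

namespace AlternatingEight

/-- Four commuting involutions, interchanged by `blockPerm`. -/
def blockInvolution : Fin 4 → Perm (Fin 8) :=
  ![swap 0 1 * swap 2 3, swap 0 2 * swap 1 3, swap 4 5 * swap 6 7, swap 4 6 * swap 5 7]

/-- A Klein group which permutes the four involutions `blockInvolution`. -/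
def blockPerm : Fin 4 → Perm (Fin 8) :=
  ![1, swap 1 2 * swap 5 6, swap 0 4 * swap 1 5 * swap 2 6 * swap 3 7,
    (swap 1 2 * swap 5 6) * (swap 0 4 * swap 1 5 * swap 2 6 * swap 3 7)]

/-- The product of the involutions `blockInvolution` with `ε i = -1`. -/
def signProd (ε : Fin 4 → ℤˣ) : Perm (Fin 8) :=
  ((List.finRange 4).map fun i => if ε i = 1 then 1 else blockInvolution i).prod

/-- The homomorphism `{±1}⁴ → 𝔖₈` defined by the involutions `blockInvolution`. -/
def signHom : (Fin 4 → ℤˣ) →* Perm (Fin 8) where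
  toFun := signProd
  map_one' := by decide +kernel
  map_mul' := by decide +kernel

/-- The homomorphism from the Klein group to `𝔖₈` defined by `blockPerm`. -/
def kleinHom : alternatingGroup.kleinFour (Fin 4) →* Perm (Fin 8) where
  toFun σ := blockPerm (σ.1.1 0)
  map_one' := rfl
  map_mul' σ τ := by
    obtain ⟨j, rfl⟩ := exists_eq_klein σ
    obtain ⟨l, rfl⟩ := exists_eq_klein τ
    have : ∀ j l, blockPerm (doubleTransposition j (doubleTransposition l 0)) =
        blockPerm (doubleTransposition j 0) * blockPerm (doubleTransposition l 0) := by decide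
    exact this j l

/-- The resulting homomorphism `KleinSemidirect → 𝔖₈`. -/
def toPerm : KleinSemidirect →* Perm (Fin 8) :=
  SemidirectProduct.lift signHom kleinHom fun σ => by
    obtain ⟨j, rfl⟩ := exists_eq_klein σ
    ext1 ε
    -- Conjugation by `blockPerm` permutes the involutions as the double transpositions permute
    -- indices: `(1 2)(5 6)` exchanges the two involutions within each block of four letters, and
    -- the other generator exchanges the blocks.
    have : ∀ (j : Fin 4) (ε : Fin 4 → ℤˣ), signProd (fun i => ε ((doubleTransposition j)⁻¹ i)) =
        blockPerm (doubleTransposition j 0) * signProd ε *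
          (blockPerm (doubleTransposition j 0))⁻¹ := by
      decide +kernel
    exact this j ε

theorem toPerm_mem (k : KleinSemidirect) : toPerm k ∈ alternatingGroup (Fin 8) := by
  have : ∀ (j : Fin 4) (ε : Fin 4 → ℤˣ),
      Perm.sign (signProd ε * blockPerm (doubleTransposition j 0)) = 1 := by
    decide +kernel
  obtain ⟨ε, σ⟩ := k
  obtain ⟨j, rfl⟩ := exists_eq_klein σ
  exact this j ε

theorem toPerm_injective : Function.Injective toPerm := by
  have : ∀ (j : Fin 4) (ε : Fin 4 → ℤˣ),
      signProd ε * blockPerm (doubleTransposition j 0) = 1 → ε = 1 ∧ j = 0 := by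
    decide +kernel
  refine (injective_iff_map_eq_one _).2 ?_
  rintro ⟨ε, σ⟩ hk
  obtain ⟨j, rfl⟩ := exists_eq_klein σ
  obtain ⟨rfl, rfl⟩ := this j ε hk
  rfl

/-- The order of `𝔄₈` is `20160 = 64 * 315`. -/
theorem nonempty_sylow_mulEquiv (Q : Sylow 2 (alternatingGroup (Fin 8))) :
    Nonempty (Q ≃* KleinSemidirect) := by
  refine KleinSemidirect.nonempty_sylow_mulEquiv (f := toPerm.codRestrict _ toPerm_mem) (m := 315)
    (fun x y h => toPerm_injective (congrArg Subtype.val h)) ?_ (by decide) Q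
  rw [nat_card_alternatingGroup, Nat.card_fin]
  decide

end AlternatingEight

/-! ### Reflections -/

namespace Reflection

variable {R : Type*} [CommRing R]

/-- The map `x ↦ x - 2 (x ⬝ᵥ r) r`. -/
def reflect (r x : Fin 4 → R) : Fin 4 → R := x - (2 * (x ⬝ᵥ r)) • r

theorem reflect_dotProduct_reflect {r : Fin 4 → R} (hr : r ⬝ᵥ r = 1) (x y : Fin 4 → R) :
    reflect r x ⬝ᵥ reflect r y = x ⬝ᵥ y := by
  simp only [reflect, sub_dotProduct, dotProduct_sub, smul_dotProduct, dotProduct_smul, hr,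
    smul_eq_mul, dotProduct_comm r]
  ring

theorem reflect_involutive {r : Fin 4 → R} (hr : r ⬝ᵥ r = 1) :
    Function.Involutive (reflect r) := by
  intro x
  simp only [reflect, sub_dotProduct, smul_dotProduct, hr, smul_eq_mul]
  module

theorem reflect_neg (r : Fin 4 → R) : reflect (-r) = reflect r := by
  ext1 x
  simp [reflect]

theorem reflect_reflect {r : Fin 4 → R} (hr : r ⬝ᵥ r = 1) (s x : Fin 4 → R) :
    reflect (reflect r s) x = reflect r (reflect s (reflect r x)) := by
  have h : x ⬝ᵥ reflect r s = reflect r x ⬝ᵥ s := by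
    rw [← reflect_dotProduct_reflect hr, reflect_involutive hr]
  have hlin (y : Fin 4 → R) (c : R) : reflect r (y - c • s) = reflect r y - c • reflect r s := by
    simp only [reflect, sub_dotProduct, smul_dotProduct, smul_eq_mul]
    module
  rw [reflect.eq_1 (reflect r s), h, reflect.eq_1 s, hlin, reflect_involutive hr]

variable (R) in
/-- A vector of square length one. -/
abbrev UnitVector : Type _ := {r : Fin 4 → R // r ⬝ᵥ r = 1}

/-- The reflection defined by a unit vector. -/
def reflection (r : UnitVector R) : Perm (Fin 4 → R) := (reflect_involutive r.2).toPerm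

theorem reflection_apply (r : UnitVector R) (x : Fin 4 → R) :
    reflection r x = reflect r.1 x := rfl

theorem reflection_mul_self (r : UnitVector R) : reflection r * reflection r = 1 := by
  ext1 x
  exact reflect_involutive r.2 x

theorem reflection_inv (r : UnitVector R) : (reflection r)⁻¹ = reflection r :=
  inv_eq_of_mul_eq_one_left (reflection_mul_self r)

/-- The reflection of a unit vector. -/
def image (r s : UnitVector R) : UnitVector R :=
  ⟨reflect r.1 s.1, by rw [reflect_dotProduct_reflect r.2, s.2]⟩

theorem reflection_image (r s : UnitVector R) :
    reflection (image r s) = reflection r * reflection s * reflection r := by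
  ext1 x
  exact reflect_reflect r.2 s.1 x

theorem reflection_mul_pow_two {r s : UnitVector R} (h : reflect r.1 s.1 = s.1) :
    (reflection r * reflection s) ^ 2 = 1 := by
  have h' : image r s = s := Subtype.ext h
  have := reflection_image r s
  rw [h'] at this
  rw [pow_two, ← mul_assoc, ← this, reflection_mul_self]

/-- With `r`, `s` denoting the reflections, `(r s)³ = (r s r)(s r s)` is a product of two
reflections in image vectors, so the relation becomes an equality of vectors. The fifth power is
treated in the same way. -/
theorem reflection_mul_pow_three {r s : UnitVector R} (h : reflect r.1 s.1 = reflect s.1 r.1) :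
    (reflection r * reflection s) ^ 3 = 1 := by
  have h' : image r s = image s r := Subtype.ext h
  calc (reflection r * reflection s) ^ 3
      = reflection (image r s) * reflection (image s r) := by
        simp only [reflection_image, pow_succ, pow_zero, one_mul, mul_assoc]
    _ = 1 := by rw [h', reflection_mul_self]

theorem reflection_mul_pow_five {r s : UnitVector R}
    (h : reflect r.1 (reflect s.1 r.1) = reflect s.1 (reflect r.1 s.1)) :
    (reflection r * reflection s) ^ 5 = 1 := by
  have h' : image r (image s r) = image s (image r s) := Subtype.ext h
  calc (reflection r * reflection s) ^ 5
      = reflection (image r (image s r)) * reflection (image s (image r s)) := by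
        simp only [reflection_image, pow_succ, pow_zero, one_mul, mul_assoc]
    _ = 1 := by rw [h', reflection_mul_self]

theorem reflection_commute {r s : UnitVector R} (h : reflect r.1 s.1 = s.1) :
    Commute (reflection r) (reflection s) := by
  have := reflection_mul_pow_two h
  rw [pow_two, mul_eq_one_iff_eq_inv, mul_inv_rev, reflection_inv, reflection_inv] at this
  exact this

/-- A vector is a root of a group of permutations if it has square length one and the group
contains the corresponding reflection. -/
def IsRoot (W : Subgroup (Perm (Fin 4 → R))) (r : Fin 4 → R) : Prop :=
  ∃ h : r ⬝ᵥ r = 1, reflection ⟨r, h⟩ ∈ W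

theorem IsRoot.of_reflect {W : Subgroup (Perm (Fin 4 → R))} {r s t : Fin 4 → R}
    (hr : IsRoot W r) (hs : IsRoot W s) (ht : t = reflect r s ∨ t = -reflect r s) :
    IsRoot W t := by
  obtain ⟨hr1, hr⟩ := hr
  obtain ⟨hs1, hs⟩ := hs
  have h1 : reflect r s ⬝ᵥ reflect r s = 1 := by rw [reflect_dotProduct_reflect hr1, hs1]
  have hmem : reflection ⟨reflect r s, h1⟩ ∈ W := by
    rw [show (⟨reflect r s, h1⟩ : UnitVector R) = image ⟨r, hr1⟩ ⟨s, hs1⟩ from rfl,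
      reflection_image]
    exact W.mul_mem (W.mul_mem hr hs) hr
  rcases ht with rfl | rfl
  · exact ⟨h1, hmem⟩
  · refine ⟨by simpa using h1, ?_⟩
    convert hmem using 1
    ext1 x
    exact congrFun (reflect_neg _) x

end Reflection

/-- If a group of permutations contains two commuting elements of order `p`, the second one moving
a point fixed by the first one, then its order is divisible by `p ^ 2`. -/
theorem sq_dvd_card_of_commute {α : Type*} {p : ℕ} [hp : Fact p.Prime] {W : Subgroup (Perm α)}
    [Finite W] {a b : Perm α} (ha : a ∈ W) (hb : b ∈ W) (hap : a ^ p = 1) (hbp : b ^ p = 1)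
    (hab : Commute a b) (ha1 : a ≠ 1) {x : α} (hax : a x = x) (hbx : b x ≠ x) :
    p ^ 2 ∣ Nat.card W := by
  let a' : W := ⟨a, ha⟩
  let b' : W := ⟨b, hb⟩
  have hoa : orderOf a' = p := orderOf_eq_prime (Subtype.ext hap)
    fun h => ha1 (congrArg Subtype.val h)
  have hob : orderOf b' = p := orderOf_eq_prime (Subtype.ext hbp) fun h => hbx (by
    have : b = 1 := congrArg Subtype.val h
    rw [this]; rfl)
  have hcomm : ∀ (u : Subgroup.zpowers a') (v : Subgroup.zpowers b'),
      Commute ((Subgroup.zpowers a').subtype u) ((Subgroup.zpowers b').subtype v) := by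
    rintro ⟨_, m, rfl⟩ ⟨_, n, rfl⟩
    have h : Commute a' b' := Subtype.ext hab
    exact (h.zpow_left m).zpow_right n
  -- As `⟨b⟩` has prime order, a nontrivial intersection would make `b` a power of `a`, and then `b`
  -- would fix `x`.
  have hdisj : Disjoint (Subgroup.zpowers a') (Subgroup.zpowers b') := by
    have : Fact (Nat.card (Subgroup.zpowers b')).Prime := ⟨by
      rw [Nat.card_zpowers, hob]; exact hp.out⟩
    rcases ((Subgroup.zpowers a').subgroupOf
      (Subgroup.zpowers b')).eq_bot_or_eq_top_of_prime_card with h | h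
    · exact Subgroup.subgroupOf_eq_bot.1 h
    · obtain ⟨n, hn⟩ := Subgroup.subgroupOf_eq_top.1 h (Subgroup.mem_zpowers b')
      have hn' : a ^ n = b := congrArg Subtype.val hn
      exact absurd (hn' ▸ Perm.zpow_apply_eq_self_of_apply_eq_self hax n) hbx
  have hinj : Function.Injective
      (MonoidHom.noncommCoprod (Subgroup.zpowers a').subtype (Subgroup.zpowers b').subtype hcomm) := by
    rw [MonoidHom.noncommCoprod_injective]
    simpa using hdisj
  have := Subgroup.card_dvd_of_injective _ hinj
  rwa [Nat.card_prod, Nat.card_zpowers, Nat.card_zpowers, hoa, hob, ← pow_two] at this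

open Reflection in
/-- The product of the reflections in two roots and the product of the reflections in two roots
orthogonal to them generate a group of order `p ^ 2`. -/
theorem Reflection.IsRoot.sq_dvd_card {R : Type*} [CommRing R] {p : ℕ} [Fact p.Prime]
    {W : Subgroup (Perm (Fin 4 → R))} [Finite W] {r s t u : Fin 4 → R} (hr : IsRoot W r)
    (hs : IsRoot W s) (ht : IsRoot W t) (hu : IsRoot W u)
    (hrs : ∀ hr hs, (reflection (R := R) ⟨r, hr⟩ * reflection ⟨s, hs⟩) ^ p = 1)
    (htu : ∀ ht hu, (reflection (R := R) ⟨t, ht⟩ * reflection ⟨u, hu⟩) ^ p = 1)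
    (hrt : reflect r t = t) (hru : reflect r u = u) (hst : reflect s t = t)
    (hsu : reflect s u = u) (hr' : reflect r (reflect s r) ≠ r)
    (ht' : reflect t (reflect u t) ≠ t) : p ^ 2 ∣ Nat.card W := by
  obtain ⟨hr1, hr⟩ := hr
  obtain ⟨hs1, hs⟩ := hs
  obtain ⟨ht1, ht⟩ := ht
  obtain ⟨hu1, hu⟩ := hu
  refine sq_dvd_card_of_commute (x := t) (W.mul_mem hr hs) (W.mul_mem ht hu) (hrs hr1 hs1)
    (htu ht1 hu1) ?_ ?_ ?_ ht'
  · exact ((reflection_commute hrt).mul_right (reflection_commute hru)).mul_left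
      ((reflection_commute hst).mul_right (reflection_commute hsu))
  · intro h
    exact hr' (congrArg (fun σ : Perm (Fin 4 → R) => σ r) h)
  · change reflect r (reflect s t) = t
    rw [hst, hrt]

/-! ### The reflection representation of `H₄` modulo `√5` and the order of the group -/

namespace CoxeterH4

open Reflection CoxeterMatrix

/-- The reduction modulo `√5` of a system of simple roots of type `H₄`. -/
def simpleRoot (i : Fin 4) : UnitVector (ZMod 5) :=
  -- In `𝔽₅` both `1/2` and `φ = (1 + √5)/2` become `3`; the inner products `-1/2` and `-φ/2` of
  -- adjacent simple roots become `2` and `1`.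
  ⟨![![3, 2, 2, 2], ![0, 1, 0, 0], ![2, 2, 2, 3], ![1, 0, 4, 2]] i, by revert i; decide⟩

/-- The order of the product of two simple reflections. -/
def braidOrder (i j : Fin 4) : ℕ := H₄ i j

theorem isLiftable_simpleRoot : H₄.IsLiftable fun i => reflection (simpleRoot i) := by
  have h2 : ∀ i j, braidOrder i j = 2 →
      reflect (simpleRoot i).1 (simpleRoot j).1 = (simpleRoot j).1 := by
    decide
  have h3 : ∀ i j, braidOrder i j = 3 → reflect (simpleRoot i).1 (simpleRoot j).1 =
      reflect (simpleRoot j).1 (simpleRoot i).1 := by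
    decide
  have h5 : ∀ i j, braidOrder i j = 5 →
      reflect (simpleRoot i).1 (reflect (simpleRoot j).1 (simpleRoot i).1) =
        reflect (simpleRoot j).1 (reflect (simpleRoot i).1 (simpleRoot j).1) := by
    decide
  have hcases : ∀ i j, (braidOrder i j = 1 ∧ i = j) ∨ braidOrder i j = 2 ∨
      braidOrder i j = 3 ∨ braidOrder i j = 5 := by
    decide
  intro i j
  change (_ * _) ^ braidOrder i j = 1
  rcases hcases i j with ⟨h, rfl⟩ | h | h | h <;> rw [h]
  · rw [pow_one, reflection_mul_self]
  · exact reflection_mul_pow_two (h2 i j h)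
  · exact reflection_mul_pow_three (h3 i j h)
  · exact reflection_mul_pow_five (h5 i j h)

/-- The reduction modulo `√5` of the reflection representation. -/
def toPerm : H₄.Group →* Perm (Fin 4 → ZMod 5) :=
  H₄.toCoxeterSystem.lift ⟨_, isLiftable_simpleRoot⟩

theorem toPerm_simple (i : Fin 4) : toPerm (H₄.simple i) = reflection (simpleRoot i) :=
  H₄.toCoxeterSystem.lift_apply_simple isLiftable_simpleRoot i

theorem isRoot_simpleRoot (i : Fin 4) : IsRoot toPerm.range (simpleRoot i).1 :=
  ⟨(simpleRoot i).2, H₄.simple i, toPerm_simple i⟩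

/-- The basis vectors give the sign changes, the next three vectors the double transpositions, and
the last two the subgroups of order `25` and `9`. -/
theorem isRoot_vectors :
    IsRoot toPerm.range ![1, 0, 0, 0] ∧
    IsRoot toPerm.range ![0, 1, 0, 0] ∧
    IsRoot toPerm.range ![0, 0, 1, 0] ∧
    IsRoot toPerm.range ![0, 0, 0, 1] ∧
    IsRoot toPerm.range ![2, 2, 3, 3] ∧
    IsRoot toPerm.range ![2, 3, 2, 3] ∧
    IsRoot toPerm.range ![2, 3, 3, 2] ∧
    IsRoot toPerm.range ![0, 1, 3, 4] ∧
    IsRoot toPerm.range ![1, 0, 2, 4] := by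
  have h2333 : IsRoot toPerm.range ![3, 2, 2, 2] := isRoot_simpleRoot 0
  have h0100 : IsRoot toPerm.range ![0, 1, 0, 0] := isRoot_simpleRoot 1
  have h2223 : IsRoot toPerm.range ![2, 2, 2, 3] := isRoot_simpleRoot 2
  have h1042 : IsRoot toPerm.range ![1, 0, 4, 2] := isRoot_simpleRoot 3
  have h2101 : IsRoot toPerm.range ![2, 1, 0, 1] := h2223.of_reflect h1042 (by decide)
  have h2323 : IsRoot toPerm.range ![2, 3, 2, 3] := h2223.of_reflect h0100 (by decide)
  have h2233 : IsRoot toPerm.range ![2, 2, 3, 3] := h0100.of_reflect h2333 (by decide)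
  have h0244 : IsRoot toPerm.range ![0, 2, 4, 4] := h1042.of_reflect h2223 (by decide)
  have h1103 : IsRoot toPerm.range ![1, 1, 0, 3] := h2323.of_reflect h0244 (by decide)
  have h0010 : IsRoot toPerm.range ![0, 0, 1, 0] := h2233.of_reflect h2223 (by decide)
  have h0211 : IsRoot toPerm.range ![0, 2, 1, 1] := h1042.of_reflect h2323 (by decide)
  have h1012 : IsRoot toPerm.range ![1, 0, 1, 2] := h2233.of_reflect h2101 (by decide)
  have h2440 : IsRoot toPerm.range ![2, 4, 4, 0] := h0244.of_reflect h2323 (by decide)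
  have h0134 : IsRoot toPerm.range ![0, 1, 3, 4] := h1012.of_reflect h2440 (by decide)
  have h2232 : IsRoot toPerm.range ![2, 2, 3, 2] := h2440.of_reflect h1012 (by decide)
  have h1024 : IsRoot toPerm.range ![1, 0, 2, 4] := h1103.of_reflect h0134 (by decide)
  have h2332 : IsRoot toPerm.range ![2, 3, 3, 2] := h2232.of_reflect h0100 (by decide)
  have h1000 : IsRoot toPerm.range ![1, 0, 0, 0] := h2323.of_reflect h2232 (by decide)
  have h0001 : IsRoot toPerm.range ![0, 0, 0, 1] := h0211.of_reflect h0134 (by decide)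
  exact ⟨h1000, h0100, h0010, h0001, h2233, h2323, h2332, h0134, h1024⟩

theorem signedPerm_signChange_mem (i : Fin 4) :
    KleinSemidirect.signedPerm (ZMod 5) (KleinSemidirect.signChange i) ∈ toPerm.range := by
  have hmem : IsRoot toPerm.range (Pi.single i 1) := by
    obtain ⟨h0, h1, h2, h3, -⟩ := isRoot_vectors
    fin_cases i
    · convert h0 using 1; decide
    · convert h1 using 1; decide
    · convert h2 using 1; decide
    · convert h3 using 1; decide
  obtain ⟨h1, h⟩ := hmem
  convert h using 1
  ext x l
  rw [KleinSemidirect.signedPerm_signChange, reflection_apply, reflect]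
  by_cases hl : l = i
  · subst hl; simp; ring
  · simp [hl]

/-- For orthogonal roots `u`, `v` of the form `½(±1, ±1, ±1, ±1)`, the product of the reflections is
`-1` on the plane spanned by `u + v` and `u - v` and `1` on its complement. Here `u ± v` are, up to
sign, differences of two basis vectors, so the product is a double transposition. -/
theorem signedPerm_klein_mem (j : Fin 4) :
    KleinSemidirect.signedPerm (ZMod 5) (SemidirectProduct.inr (klein j)) ∈ toPerm.range := by
  obtain ⟨-, -, -, -, ha, hb, hc, -⟩ := isRoot_vectors
  have key {u v : Fin 4 → ZMod 5} (hu : IsRoot toPerm.range u) (hv : IsRoot toPerm.range v)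
      (h : ∀ x₀ x₁ x₂ x₃, reflect u (reflect v ![x₀, x₁, x₂, x₃]) =
        ![x₀, x₁, x₂, x₃] ∘ doubleTransposition j) :
      KleinSemidirect.signedPerm (ZMod 5) (SemidirectProduct.inr (klein j)) ∈ toPerm.range := by
    obtain ⟨hu1, hu⟩ := hu
    obtain ⟨hv1, hv⟩ := hv
    convert toPerm.range.mul_mem hu hv using 1
    ext1 x
    have hx : x = ![x 0, x 1, x 2, x 3] := by
      ext l; fin_cases l <;> rfl
    rw [KleinSemidirect.signedPerm_klein, hx]
    exact (h _ _ _ _).symm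
  fin_cases j
  · exact ⟨1, by rw [map_one]; exact (map_one _).symm⟩
  · exact key hb hc (by decide +kernel)
  · exact key ha hc (by decide +kernel)
  · exact key ha hb (by decide +kernel)

theorem range_signedPerm_le : (KleinSemidirect.signedPerm (ZMod 5)).range ≤ toPerm.range :=
  KleinSemidirect.range_signedPerm_le signedPerm_signChange_mem
    fun j => ⟨1, signedPerm_klein_mem j⟩

theorem signedPerm_injective : Function.Injective (KleinSemidirect.signedPerm (ZMod 5)) :=
  KleinSemidirect.signedPerm_injective (by decide)

/-- A root subsystem `A₂ × A₂`. -/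
theorem nine_dvd_card_range : 3 ^ 2 ∣ Nat.card toPerm.range := by
  obtain ⟨-, -, -, -, -, -, -, -, h⟩ := isRoot_vectors
  exact (isRoot_simpleRoot 0).sq_dvd_card (isRoot_simpleRoot 1) h (isRoot_simpleRoot 3)
    (fun _ _ => reflection_mul_pow_three (by decide +revert))
    (fun _ _ => reflection_mul_pow_three (by decide +revert))
    (by decide) (by decide) (by decide) (by decide) (by decide) (by decide)

/-- A root subsystem `I₂(5) × I₂(5)`. -/
theorem twentyfive_dvd_card_range : 5 ^ 2 ∣ Nat.card toPerm.range := by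
  obtain ⟨-, -, -, -, -, -, -, h, -⟩ := isRoot_vectors
  have : Fact (Nat.Prime 5) := ⟨by norm_num⟩
  exact (isRoot_simpleRoot 2).sq_dvd_card (isRoot_simpleRoot 3) (isRoot_simpleRoot 0) h
    (fun _ _ => reflection_mul_pow_five (by decide +revert))
    (fun _ _ => reflection_mul_pow_five (by decide +revert))
    (by decide) (by decide) (by decide) (by decide) (by decide) (by decide)

theorem card_range_toPerm : Nat.card toPerm.range = 14400 := by
  have h64 : 64 ∣ Nat.card toPerm.range := by
    rw [← KleinSemidirect.card,
      Nat.card_congr (MonoidHom.ofInjective signedPerm_injective).toEquiv]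
    exact Subgroup.card_dvd_of_le range_signedPerm_le
  have h : 64 * (3 ^ 2 * 5 ^ 2) ∣ Nat.card toPerm.range :=
    Nat.Coprime.mul_dvd_of_dvd_of_dvd (by decide) h64
      (Nat.Coprime.mul_dvd_of_dvd_of_dvd (by decide) nine_dvd_card_range
        twentyfive_dvd_card_range)
  refine le_antisymm ?_ (Nat.le_of_dvd Nat.card_pos h)
  exact (Nat.card_le_card_of_surjective _ toPerm.rangeRestrict_surjective).trans card_group_le

theorem toPerm_injective : Function.Injective toPerm := by
  have hcard : Nat.card H₄.Group = Nat.card toPerm.range :=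
    le_antisymm (card_group_le.trans card_range_toPerm.ge)
      (Nat.card_le_card_of_surjective _ toPerm.rangeRestrict_surjective)
  exact MonoidHom.rangeRestrict_injective_iff.1
    ((Nat.bijective_iff_surjective_and_card _).2 ⟨toPerm.rangeRestrict_surjective, hcard⟩).1

theorem card_group : Nat.card H₄.Group = 14400 := by
  rw [← card_range_toPerm, Nat.card_congr (MonoidHom.ofInjective toPerm_injective).toEquiv]

theorem nonempty_sylow_mulEquiv (P : Sylow 2 H₄.Group) : Nonempty (P ≃* KleinSemidirect) := by
  let f : KleinSemidirect →* H₄.Group :=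
    (MonoidHom.ofInjective toPerm_injective).symm.toMonoidHom.comp
      ((Subgroup.inclusion range_signedPerm_le).comp
        (KleinSemidirect.signedPerm (ZMod 5)).rangeRestrict)
  refine KleinSemidirect.nonempty_sylow_mulEquiv (f := f) (m := 225) ?_ card_group (by decide) P
  exact (MonoidHom.ofInjective toPerm_injective).symm.injective.comp
    ((Subgroup.inclusion_injective range_signedPerm_le).comp
      (MonoidHom.rangeRestrict_injective_iff.2 signedPerm_injective))

end CoxeterH4

/-! ### The group `𝔖₂ ⋉ (Q₈ × Q₈)` -/

open scoped Quaternion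

namespace KleinSemidirect

variable {R : Type*} [Ring R] (ε : Fin 4 → ℤˣ) (a b c d : R)

theorem signedPerm_mk_klein_zero : signedPerm R ⟨ε, klein 0⟩ ![a, b, c, d] =
    ![ε 0 • a, ε 1 • b, ε 2 • c, ε 3 • d] := by
  ext l; fin_cases l <;> rfl

theorem signedPerm_mk_klein_one : signedPerm R ⟨ε, klein 1⟩ ![a, b, c, d] =
    ![ε 0 • b, ε 1 • a, ε 2 • d, ε 3 • c] := by
  ext l; fin_cases l <;> rfl

theorem signedPerm_mk_klein_two : signedPerm R ⟨ε, klein 2⟩ ![a, b, c, d] =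
    ![ε 0 • c, ε 1 • d, ε 2 • a, ε 3 • b] := by
  ext l; fin_cases l <;> rfl

theorem signedPerm_mk_klein_three : signedPerm R ⟨ε, klein 3⟩ ![a, b, c, d] =
    ![ε 0 • d, ε 1 • c, ε 2 • b, ε 3 • a] := by
  ext l; fin_cases l <;> rfl

end KleinSemidirect

noncomputable section

namespace Quat

@[simp] theorem i_re : i.re = 0 := rfl

@[simp] theorem i_imI : i.imI = 1 := rfl

@[simp] theorem i_imJ : i.imJ = 0 := rfl

@[simp] theorem i_imK : i.imK = 0 := rfl

@[simp] theorem j_re : j.re = 0 := rfl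

@[simp] theorem j_imI : j.imI = 0 := rfl

@[simp] theorem j_imJ : j.imJ = 1 := rfl

@[simp] theorem j_imK : j.imK = 0 := rfl

@[simp] theorem k_re : k.re = 0 := rfl

@[simp] theorem k_imI : k.imI = 0 := rfl

@[simp] theorem k_imJ : k.imJ = 0 := rfl

@[simp] theorem k_imK : k.imK = 1 := rfl

end Quat

namespace Q8

theorem star_eq_inv (c : Q8) : star (c.1 : ℍ[ℝ]) = (c.1⁻¹ : ℍ[ℝ]ˣ) := by
  refine (Units.inv_eq_of_mul_eq_one_left ?_).symm
  rcases c.2 with h | h | h | h | h | h | h | h <;> rw [h] <;> ext <;> simp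

/-- The element `i` of the quaternion group. -/
def i : Q8 := ⟨⟨Quat.i, -Quat.i, by simp [Quat.i_mul_i], by simp [Quat.i_mul_i]⟩,
  Or.inr (Or.inr (Or.inl rfl))⟩

/-- The element `j` of the quaternion group. -/
def j : Q8 := ⟨⟨Quat.j, -Quat.j, by simp [Quat.j_mul_j], by simp [Quat.j_mul_j]⟩,
  Or.inr (Or.inr (Or.inr (Or.inr (Or.inl rfl))))⟩

/-- The element `k` of the quaternion group. -/
def k : Q8 := ⟨⟨Quat.k, -Quat.k, by simp [Quat.k_mul_k], by simp [Quat.k_mul_k]⟩,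
  Or.inr (Or.inr (Or.inr (Or.inr (Or.inr (Or.inr (Or.inl rfl))))))⟩

/-- A central element is `±1`. -/
theorem eq_one_or_eq_negOne {c : Q8} (hi : (c.1 : ℍ[ℝ]) * Quat.i = Quat.i * c.1)
    (hj : (c.1 : ℍ[ℝ]) * Quat.j = Quat.j * c.1) : c = 1 ∨ c = negOne := by
  rcases c.2 with h | h | h | h | h | h | h | h
  · exact Or.inl (Subtype.ext (Units.ext h))
  · exact Or.inr (Subtype.ext (Units.ext h))
  all_goals
    exfalso
    rw [h] at hi hj
    have hi0 := congrArg QuaternionAlgebra.imJ hi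
    have hi1 := congrArg QuaternionAlgebra.imK hi
    have hj1 := congrArg QuaternionAlgebra.imK hj
    revert hi0 hi1 hj1
    norm_num

/-- The quaternion group is generated by `-1`, `i`, `j`, `k`. -/
theorem eq_top_of_mem {T : Subgroup Q8} (h1 : negOne ∈ T) (hi : i ∈ T) (hj : j ∈ T)
    (hk : k ∈ T) : T = ⊤ := by
  refine (Subgroup.eq_top_iff' T).2 fun c => ?_
  have hpos {a : Q8} (ha : a ∈ T) (h : (c.1 : ℍ[ℝ]) = a.1) : c ∈ T := by
    rwa [show c = a from Subtype.ext (Units.ext h)]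
  have hneg {a : Q8} (ha : a ∈ T) (h : (c.1 : ℍ[ℝ]) = -a.1) : c ∈ T :=
    hpos (T.mul_mem h1 ha) (by rw [h]; simp [negOne])
  rcases c.2 with h | h | h | h | h | h | h | h
  · exact hpos T.one_mem h
  · exact hneg T.one_mem h
  · exact hpos hi h
  · exact hneg hi h
  · exact hpos hj h
  · exact hneg hj h
  · exact hpos hk h
  · exact hneg hk h

end Q8

namespace Q8Wreath

theorem perm_two_cases (σ : Perm (Fin 2)) : σ = 1 ∨ σ = swap 0 1 := by
  revert σ; decide

/-- The pair `(a, b)` acts on the quaternions by `x ↦ a x b⁻¹`. -/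
def pairAction : (Fin 2 → Q8) →* Perm ℍ[ℝ] :=
  MonoidHom.toHomPerm
    { toFun c := fun x => (c 0).1 * x * ((c 1).1⁻¹ : ℍ[ℝ]ˣ)
      map_one' := by funext x; simp; rfl
      map_mul' c d := by
        funext x
        change _ = ((c 0).1 : ℍ[ℝ]) * ((d 0).1 * x * ((d 1).1⁻¹ : ℍ[ℝ]ˣ)) * ((c 1).1⁻¹ : ℍ[ℝ]ˣ)
        simp [mul_assoc] }

theorem pairAction_apply (c : Fin 2 → Q8) (x : ℍ[ℝ]) :
    pairAction c x = (c 0).1 * x * ((c 1).1⁻¹ : ℍ[ℝ]ˣ) := rfl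

/-- The conjugation of quaternions. -/
def conjPerm : Perm ℍ[ℝ] := Function.Involutive.toPerm star star_star

/-- The transposition acts on the quaternions by conjugation. -/
def swapAction : Perm (Fin 2) →* Perm ℍ[ℝ] where
  toFun σ := if σ = 1 then 1 else conjPerm
  map_one' := if_pos rfl
  map_mul' σ τ := by
    have hsq : conjPerm * conjPerm = 1 := by
      ext1 x; exact star_star x
    have hne : (swap 0 1 : Perm (Fin 2)) ≠ 1 := by decide
    rcases perm_two_cases σ with rfl | rfl <;> rcases perm_two_cases τ with rfl | rfl <;>
      simp [hne, hsq]

theorem swapAction_swap : swapAction (swap 0 1) = conjPerm := by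
  have hne : (swap 0 1 : Perm (Fin 2)) ≠ 1 := by decide
  exact if_neg (t := 1) hne

/-- The action of `𝔖₂ ⋉ (Q₈ × Q₈)` on the quaternions. -/
def action : Q8Wreath →* Perm ℍ[ℝ] :=
  SemidirectProduct.lift pairAction swapAction fun σ => by
    rcases perm_two_cases σ with rfl | rfl
    · simp only [map_one]
      rfl
    · ext c x : 2
      change pairAction (fun l => c ((swap 0 1 : Perm (Fin 2))⁻¹ l)) x =
        (swapAction (swap 0 1) * pairAction c * (swapAction (swap 0 1))⁻¹) x
      rw [swapAction_swap]
      change _ = star (pairAction c (star x))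
      -- Elements of `Q8` have norm one, so the conjugate of `a x̄ b⁻¹` is `b x a⁻¹`.
      simp [pairAction_apply, Q8.star_eq_inv, mul_assoc]

theorem action_inl (c : Fin 2 → Q8) (x : ℍ[ℝ]) :
    action (SemidirectProduct.inl c) x = (c 0).1 * x * ((c 1).1⁻¹ : ℍ[ℝ]ˣ) := by
  rw [action, SemidirectProduct.lift_inl, pairAction_apply]

theorem action_inr_swap (x : ℍ[ℝ]) : action (SemidirectProduct.inr (swap 0 1)) x = star x := by
  rw [action, SemidirectProduct.lift_inr, swapAction_swap]
  rfl

/-- Evaluation at `1` gives `a = b`. Without the transposition, `a` then commutes with `i` and `j`,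
so `a = ±1`. With it, `a x̄ = x a` for all `x`: the real parts at `i`, `j`, `k` make `a` real, and
the `i`-coordinate at `x = i` makes it zero. -/
theorem ker_action : action.ker = negOneNegOne := by
  apply le_antisymm
  · rintro ⟨c, σ⟩ h
    have h' : action (SemidirectProduct.inl c * SemidirectProduct.inr σ) = 1 := by
      rw [← SemidirectProduct.mk_eq_inl_mul_inr]; exact h
    rw [map_mul] at h'
    have hx (x : ℍ[ℝ]) := congrArg (fun τ : Perm ℍ[ℝ] => τ x) h'
    simp only [Perm.mul_apply, action_inl, Perm.one_apply] at hx
    rcases perm_two_cases σ with rfl | rfl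
    · simp only [map_one, Perm.one_apply, Units.mul_inv_eq_iff_eq_mul] at hx
      have h01 : c 0 = c 1 := Subtype.ext (Units.ext (by simpa using hx 1))
      rw [h01] at hx
      have hc : c = fun _ => c 1 := by
        funext l; fin_cases l
        · exact h01
        · rfl
      rcases Q8.eq_one_or_eq_negOne (hx Quat.i) (hx Quat.j) with h1 | h1
      · rw [hc, h1]
        exact negOneNegOne.one_mem
      · rw [hc, h1]
        exact Subgroup.mem_zpowers _
    · exfalso
      simp only [action_inr_swap, Units.mul_inv_eq_iff_eq_mul] at hx
      have h01 : c 0 = c 1 := Subtype.ext (Units.ext (by simpa using hx 1))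
      rw [← h01] at hx
      have e0 := congrArg QuaternionAlgebra.imI (hx Quat.i)
      have e1 := congrArg QuaternionAlgebra.re (hx Quat.i)
      have e2 := congrArg QuaternionAlgebra.re (hx Quat.j)
      have e3 := congrArg QuaternionAlgebra.re (hx Quat.k)
      rcases (c 0).2 with h | h | h | h | h | h | h | h <;> rw [h] at e0 e1 e2 e3 <;>
        revert e0 e1 e2 e3 <;> norm_num
  · rw [negOneNegOne, Subgroup.zpowers_le, MonoidHom.mem_ker]
    ext1 x
    rw [action_inl]
    simp [Q8.negOne]

/-- The action of `𝔖₂ ⋉ (Q₈ × Q₈)` on the coordinates of the quaternions. -/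
def coordAction : Q8Wreath →* Perm (Fin 4 → ℝ) :=
  (Quaternion.equivTuple ℝ).permCongrHom.toMonoidHom.comp action

theorem ker_coordAction : coordAction.ker = negOneNegOne := by
  rw [← ker_action]
  exact MonoidHom.ker_comp_of_injective _ _ (MulEquiv.injective _)

/-- An element acts as a given signed permutation if it does so on all quaternions. -/
theorem coordAction_eq {w : Q8Wreath} {τ : Perm (Fin 4 → ℝ)}
    (h : ∀ x : ℍ[ℝ], ![(action w x).re, (action w x).imI, (action w x).imJ, (action w x).imK] =
      τ ![x.re, x.imI, x.imJ, x.imK]) : coordAction w = τ := by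
  ext1 y
  have hy : y = ![y 0, y 1, y 2, y 3] := by
    ext l; fin_cases l <;> rfl
  rw [hy]
  exact h ⟨y 0, y 1, y 2, y 3⟩

theorem coordAction_left_i : coordAction (SemidirectProduct.inl (Pi.mulSingle 0 Q8.i)) =
    KleinSemidirect.signedPerm ℝ ⟨![-1, 1, -1, 1], klein 1⟩ :=
  coordAction_eq fun x => by
    rw [KleinSemidirect.signedPerm_mk_klein_one, action_inl]
    simp [Q8.i]

theorem coordAction_left_j : coordAction (SemidirectProduct.inl (Pi.mulSingle 0 Q8.j)) =
    KleinSemidirect.signedPerm ℝ ⟨![-1, 1, 1, -1], klein 2⟩ :=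
  coordAction_eq fun x => by
    rw [KleinSemidirect.signedPerm_mk_klein_two, action_inl]
    simp [Q8.j]

theorem coordAction_left_k : coordAction (SemidirectProduct.inl (Pi.mulSingle 0 Q8.k)) =
    KleinSemidirect.signedPerm ℝ ⟨![-1, -1, 1, 1], klein 3⟩ :=
  coordAction_eq fun x => by
    rw [KleinSemidirect.signedPerm_mk_klein_three, action_inl]
    simp [Q8.k]

theorem coordAction_left_negOne :
    coordAction (SemidirectProduct.inl (Pi.mulSingle 0 Q8.negOne)) =
      KleinSemidirect.signedPerm ℝ ⟨-1, klein 0⟩ :=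
  coordAction_eq fun x => by
    rw [KleinSemidirect.signedPerm_mk_klein_zero, action_inl]
    simp [Q8.negOne]

theorem coordAction_swap : coordAction (SemidirectProduct.inr (swap 0 1)) =
    KleinSemidirect.signedPerm ℝ ⟨![1, -1, -1, -1], klein 0⟩ :=
  coordAction_eq fun x => by
    rw [KleinSemidirect.signedPerm_mk_klein_zero, action_inr_swap]
    simp

theorem range_coordAction_le :
    coordAction.range ≤ (KleinSemidirect.signedPerm ℝ).range := by
  have hleft : (KleinSemidirect.signedPerm ℝ).range.comap
      ((coordAction.comp SemidirectProduct.inl).comp (MonoidHom.mulSingle (fun _ => Q8) 0)) = ⊤ :=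
    Q8.eq_top_of_mem ⟨_, coordAction_left_negOne.symm⟩ ⟨_, coordAction_left_i.symm⟩
      ⟨_, coordAction_left_j.symm⟩ ⟨_, coordAction_left_k.symm⟩
  have h0 (a : Q8) : coordAction (SemidirectProduct.inl (Pi.mulSingle 0 a)) ∈
      (KleinSemidirect.signedPerm ℝ).range := (Subgroup.eq_top_iff' _).1 hleft a
  have hswap : coordAction (SemidirectProduct.inr (swap 0 1)) ∈
      (KleinSemidirect.signedPerm ℝ).range := ⟨_, coordAction_swap.symm⟩
  -- The second factor is conjugate to the first under the transposition.
  have h1 (a : Q8) : coordAction (SemidirectProduct.inl (Pi.mulSingle 1 a)) ∈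
      (KleinSemidirect.signedPerm ℝ).range := by
    have : (Pi.mulSingle 1 a : Fin 2 → Q8) = mulAutArrow (swap 0 1 : Perm (Fin 2))
        (Pi.mulSingle 0 a) := by
      funext l; fin_cases l <;> rfl
    rw [this, SemidirectProduct.inl_aut, map_mul, map_mul, map_inv, map_inv]
    exact Subgroup.mul_mem _ (Subgroup.mul_mem _ hswap (h0 a)) (Subgroup.inv_mem _ hswap)
  rintro _ ⟨⟨c, σ⟩, rfl⟩
  have hc : c = Pi.mulSingle 0 (c 0) * Pi.mulSingle 1 (c 1) := by
    funext l; fin_cases l <;> simp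
  rw [SemidirectProduct.mk_eq_inl_mul_inr, hc, map_mul, map_mul, map_mul]
  refine Subgroup.mul_mem _ (Subgroup.mul_mem _ (h0 _) (h1 _)) ?_
  rcases perm_two_cases σ with rfl | rfl
  · rw [map_one, map_one]
    exact Subgroup.one_mem _
  · exact hswap

/-- The reflection of the quaternions defined by an element `r` of the quaternion group,
`x ↦ - r (star x) r`. -/
def reflectionElement (r : Q8) : Q8Wreath :=
  SemidirectProduct.inl ![Q8.negOne * r, r⁻¹] * SemidirectProduct.inr (swap 0 1)

theorem action_reflectionElement (r : Q8) (x : ℍ[ℝ]) :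
    action (reflectionElement r) x = -(r.1 * star x * r.1) := by
  rw [reflectionElement, map_mul, Perm.mul_apply, action_inl, action_inr_swap]
  simp [Q8.negOne]

theorem coordAction_reflectionElement (l : Fin 4) :
    coordAction (reflectionElement (![1, Q8.i, Q8.j, Q8.k] l)) =
      KleinSemidirect.signedPerm ℝ (KleinSemidirect.signChange l) := by
  refine coordAction_eq fun x => ?_
  rw [action_reflectionElement, show KleinSemidirect.signChange l =
    ⟨Pi.mulSingle l (-1), klein 0⟩ from rfl, KleinSemidirect.signedPerm_mk_klein_zero]
  fin_cases l <;> simp [Q8.i, Q8.j, Q8.k]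

/-- The reflections in `1, i, j, k` are the sign changes, and left multiplications by `i`, `j`, `k`
are signed versions of the three double transpositions. -/
theorem range_coordAction : coordAction.range = (KleinSemidirect.signedPerm ℝ).range := by
  refine le_antisymm range_coordAction_le (KleinSemidirect.range_signedPerm_le
    (fun l => ⟨_, coordAction_reflectionElement l⟩) fun j => ?_)
  fin_cases j
  · exact ⟨1, 1, by rw [map_one]; exact (map_one _).symm⟩
  · exact ⟨_, _, coordAction_left_i⟩
  · exact ⟨_, _, coordAction_left_j⟩
  · exact ⟨_, _, coordAction_left_k⟩

theorem nonempty_quotient_mulEquiv :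
    Nonempty ((Q8Wreath ⧸ Q8Wreath.negOneNegOne) ≃* KleinSemidirect) :=
  ⟨(QuotientGroup.quotientMulEquivOfEq ker_coordAction.symm).trans <|
    (QuotientGroup.quotientKerEquivRange coordAction).trans <|
    (MulEquiv.subgroupCongr range_coordAction).trans
    (MonoidHom.ofInjective (KleinSemidirect.signedPerm_injective (by norm_num))).symm⟩

end Q8Wreath

end


theorem mainTheorem11 :
    Nonempty ((Q8Wreath ⧸ Q8Wreath.negOneNegOne) ≃* KleinSemidirect) ∧
    Finite CoxeterMatrix.H₄.Group ∧
    ∀ (P : Sylow 2 CoxeterMatrix.H₄.Group) (Q : Sylow 2 (alternatingGroup (Fin 8))),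
      Nonempty (P ≃* Q) ∧ Nonempty (P ≃* KleinSemidirect) ∧ Nonempty (Q ≃* KleinSemidirect) := by
  refine ⟨Q8Wreath.nonempty_quotient_mulEquiv, CoxeterH4.finite_group, fun P Q => ?_⟩
  obtain ⟨e⟩ := CoxeterH4.nonempty_sylow_mulEquiv P
  obtain ⟨e'⟩ := AlternatingEight.nonempty_sylow_mulEquiv Q
  exact ⟨⟨e.trans e'.symm⟩, ⟨e⟩, ⟨e'⟩⟩
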